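/- Let $r$ be a positive integer with $r\equiv 0\pmod 4$ and let $m_1,m_2\ge 0$ be integers. Let $Cl_r$ be the real Clifford algebra generated by $e_1,\dots,e_r$ with $e_ie_j+e_je_i=-2\delta_{ij}$, let $Cl_r^0$ be its even subalgebra, and let $\mathfrak{spin}(r)=\mathrm{span}\{e_ie_j\mid 1\le i<j\le r\}\subset Cl_r^0$ with the commutator bracket. Let $\tilde\Delta_r^+$ and $\tilde\Delta_r^-$ be the two inequivalent irreducible real representations of $Cl_r^0$, both of dimension $d_r$, realized on the Euclidean space $\mathbb{R}^{d_r}$ in such a way that every $e_ie_j$ with $i\ne j$ acts by an antisymmetric matrix. Let $\widehat{\mathfrak{spin}(r)}\subset\mathfrak{so}(d_rm_1+d_rm_2)$ be the image of $\mathfrak{spin}(r)$ under the restriction to $\mathfrak{spin}(r)$ of the representation $$\mathbb{R}^N=\tilde\Delta_r^+\otimes\mathbb{R}^{m_1}\oplus\tilde\Delta_r^-\otimes\mathbb{R}^{m_2},\qquad N=d_rm_1+d_rm_2,$$ of $Cl_r^0$, in which the factors $\mathbb{R}^{m_1}$, $\mathbb{R}^{m_2}$ are acted on trivially (by the identity).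 Then the centralizer of $\widehat{\mathfrak{spin}(r)}$ in $\mathfrak{so}(d_rm_1+d_rm_2)$ is isomorphic, as a real Lie algebra, to $$\mathfrak{so}(m_1)\oplus\mathfrak{so}(m_2)\ \text{ if } r\equiv 0 \pmod 8,\qquad \mathfrak{sp}(m_1)\oplus\mathfrak{sp}(m_2)\ \text{ if } r\equiv 4\pmod 8,$$ where $\mathfrak{sp}(m)$ is the compact symplectic Lie algebra of quaternionic $m\times m$ matrices $A$ with $A^*=-A$. -/

import Mathlib

open scoped Matrix Kronecker Quaternion

attribute [local instance 100] LieRing.ofAssociativeRing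

namespace SpinCentralizer

noncomputable section

/-- The negative definite form `v ↦ -∑ vᵢ²` on `ℝ^r`; since `ι v * ι v = Q v` in
`CliffordAlgebra Q`, it gives the relations `eᵢ eⱼ + eⱼ eᵢ = -2 δᵢⱼ`. -/
def cliffordForm (r : ℕ) : QuadraticForm ℝ (Fin r → ℝ) :=
  QuadraticMap.weightedSumSquares ℝ (fun _ : Fin r => (-1 : ℝ))

/-- The even Clifford algebra `Cl_r⁰`. -/
abbrev EvenClifford (r : ℕ) : Type :=
  CliffordAlgebra.even (cliffordForm r)

/-- The generator `eᵢ` of the Clifford algebra `Cl_r`. -/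
def gen {r : ℕ} (i : Fin r) : CliffordAlgebra (cliffordForm r) :=
  CliffordAlgebra.ι (cliffordForm r) (Pi.single i 1)

/-- The element `eᵢ eⱼ` of the even Clifford algebra. -/
def bivector {r : ℕ} (i j : Fin r) : EvenClifford r :=
  ⟨gen i * gen j, CliffordAlgebra.ι_mul_ι_mem_evenOdd_zero _ _ _⟩

theorem gen_mul_self {r : ℕ} (i : Fin r) : gen i * gen i = -1 := by
  rw [gen, CliffordAlgebra.ι_sq_scalar]
  have h : cliffordForm r (Pi.single i 1) = -1 := by
    simp [cliffordForm, QuadraticMap.weightedSumSquares_apply, Pi.single_apply]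
  rw [h, map_neg, map_one]

theorem gen_mul_swap {r : ℕ} {i j : Fin r} (h : i ≠ j) : gen j * gen i = -(gen i * gen j) := by
  have hp : QuadraticMap.polar (cliffordForm r) (Pi.single i 1) (Pi.single j 1) = 0 := by
    rw [QuadraticMap.polar]
    simp only [cliffordForm, QuadraticMap.weightedSumSquares_apply, ← Finset.sum_sub_distrib]
    refine Finset.sum_eq_zero fun k _ => ?_
    by_cases hi : k = i
    · subst hi; simp [h]
    · simp [hi]
  have := CliffordAlgebra.ι_mul_ι_add_swap (Q := cliffordForm r) (Pi.single i 1) (Pi.single j 1)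
  rw [hp, map_zero] at this
  exact eq_neg_of_add_eq_zero_right this

/-- The linear span of the bivectors `eᵢ eⱼ`, `i < j`. -/
def bivectorSpan (r : ℕ) : Submodule ℝ (EvenClifford r) :=
  Submodule.span ℝ {x | ∃ i j : Fin r, i < j ∧ x = bivector i j}

theorem bivector_swap {r : ℕ} {i j : Fin r} (h : i ≠ j) : bivector j i = -bivector i j :=
  Subtype.ext (gen_mul_swap h)

theorem bivector_mem {r : ℕ} {i j : Fin r} (h : i ≠ j) : bivector i j ∈ bivectorSpan r := by
  rcases lt_or_gt_of_ne h with h' | h'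
  · exact Submodule.subset_span ⟨i, j, h', rfl⟩
  · rw [bivector_swap h.symm]
    exact neg_mem (Submodule.subset_span ⟨j, i, h', rfl⟩)

theorem bivector_mul_self {r : ℕ} (i : Fin r) : bivector i i = -1 :=
  Subtype.ext (gen_mul_self i)

theorem bivector_mul_bivector {r : ℕ} (i j k : Fin r) :
    bivector i j * bivector j k = -bivector i k := by
  apply Subtype.ext
  change gen i * gen j * (gen j * gen k) = -(gen i * gen k)
  rw [mul_assoc, ← mul_assoc (gen j), gen_mul_self]
  simp

theorem bivector_commute {r : ℕ} {i j k l : Fin r} (hik : i ≠ k) (hil : i ≠ l) (hjk : j ≠ k)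
    (hjl : j ≠ l) : bivector i j * bivector k l = bivector k l * bivector i j := by
  apply Subtype.ext
  change gen i * gen j * (gen k * gen l) = gen k * gen l * (gen i * gen j)
  calc gen i * gen j * (gen k * gen l) = gen i * (gen j * gen k) * gen l := by noncomm_ring
    _ = -(gen i * gen k * (gen j * gen l)) := by rw [gen_mul_swap hjk.symm]; noncomm_ring
    _ = -(gen k * gen i * (gen l * gen j)) := by
        rw [gen_mul_swap hik.symm, gen_mul_swap hjl.symm]; noncomm_ring
    _ = -(gen k * (gen i * gen l) * gen j) := by noncomm_ring
    _ = gen k * gen l * (gen i * gen j) := by rw [gen_mul_swap hil.symm]; noncomm_ring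

theorem lie_bivector_mem_aux {r : ℕ} {i j l : Fin r} (hij : i ≠ j) (hjl : j ≠ l) :
    ⁅bivector i j, bivector j l⁆ ∈ bivectorSpan r := by
  by_cases hil : i = l
  · subst hil
    rw [Ring.lie_def, bivector_mul_bivector, bivector_mul_bivector, bivector_mul_self,
      bivector_mul_self, sub_self]
    exact zero_mem _
  · rw [Ring.lie_def, bivector_mul_bivector]
    rw [bivector_swap hij.symm, bivector_swap hjl.symm, neg_mul_neg, bivector_mul_bivector,
      bivector_swap hil]
    exact sub_mem (neg_mem (bivector_mem hil)) (neg_mem (neg_mem (bivector_mem hil)))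

theorem lie_bivector_mem {r : ℕ} {i j k l : Fin r} (hij : i ≠ j) (hkl : k ≠ l) :
    ⁅bivector i j, bivector k l⁆ ∈ bivectorSpan r := by
  by_cases hjk : j = k
  · subst hjk; exact lie_bivector_mem_aux hij hkl
  by_cases hjl : j = l
  · subst hjl
    rw [bivector_swap hkl.symm, lie_neg]
    exact neg_mem (lie_bivector_mem_aux hij hkl.symm)
  by_cases hik : i = k
  · subst hik
    rw [bivector_swap hij.symm, neg_lie]
    exact neg_mem (lie_bivector_mem_aux hij.symm hkl)
  by_cases hil : i = l
  · subst hil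
    rw [bivector_swap hij.symm, bivector_swap hkl.symm, neg_lie, lie_neg]
    exact neg_mem (neg_mem (lie_bivector_mem_aux hij.symm hkl.symm))
  rw [Ring.lie_def, bivector_commute hik hil hjk hjl, sub_self]
  exact zero_mem _

/-- The Lie algebra `spin(r) = span {eᵢ eⱼ | i < j}` inside the even Clifford algebra, with the
commutator bracket. -/
def spin (r : ℕ) : LieSubalgebra ℝ (EvenClifford r) :=
  { bivectorSpan r with
    lie_mem' := by
      intro x y hx hy
      change x ∈ bivectorSpan r at hx
      change y ∈ bivectorSpan r at hy
      change ⁅x, y⁆ ∈ bivectorSpan r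
      induction hx using Submodule.span_induction with
      | mem x hx =>
        obtain ⟨i, j, hij, rfl⟩ := hx
        induction hy using Submodule.span_induction with
        | mem y hy =>
          obtain ⟨k, l, hkl, rfl⟩ := hy
          exact lie_bivector_mem hij.ne hkl.ne
        | zero => rw [lie_zero]; exact zero_mem _
        | add y z _ _ hy hz => rw [lie_add]; exact add_mem hy hz
        | smul c y _ hy => rw [lie_smul]; exact Submodule.smul_mem _ c hy
      | zero => rw [zero_lie]; exact zero_mem _
      | add x z _ _ hx hz => rw [add_lie]; exact add_mem hx hz
      | smul c x _ hx => rw [smul_lie]; exact Submodule.smul_mem _ c hx }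

/-- A real matrix representation of `Cl_r⁰` on the Euclidean space `ℝ^n` in which every bivector
`eᵢ eⱼ` (`i ≠ j`) acts by an antisymmetric matrix. -/
structure OrthogonalRep (r : ℕ) (n : Type) [Fintype n] [DecidableEq n] where
  /-- The underlying homomorphism of unital real algebras. -/
  toAlgHom : EvenClifford r →ₐ[ℝ] Matrix n n ℝ
  /-- Bivectors act by antisymmetric matrices. -/
  skew : ∀ i j : Fin r, i ≠ j → (toAlgHom (bivector i j))ᵀ = -toAlgHom (bivector i j)

namespace OrthogonalRep

variable {r : ℕ} {n : Type} [Fintype n] [DecidableEq n]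

/-- Irreducibility: the space is nonzero and the only invariant subspaces are `0` and everything. -/
def IsIrreducible (ρ : OrthogonalRep r n) : Prop :=
  Nonempty n ∧ ∀ W : Submodule ℝ (n → ℝ),
    (∀ a : EvenClifford r, ∀ v ∈ W, ρ.toAlgHom a *ᵥ v ∈ W) → W = ⊥ ∨ W = ⊤

/-- Equivalence of representations of `Cl_r⁰` on the same space: there is an invertible
intertwining matrix. -/
def Equivalent (ρ σ : OrthogonalRep r n) : Prop :=
  ∃ P : (Matrix n n ℝ)ˣ, ∀ a : EvenClifford r,
    (P : Matrix n n ℝ) * ρ.toAlgHom a = σ.toAlgHom a * (P : Matrix n n ℝ)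

/-- The representation `ρ ⊗ ℝ^{m₁} ⊕ σ ⊗ ℝ^{m₂}` of `Cl_r⁰`: an element `a` acts by the block
diagonal matrix with blocks `ρ(a) ⊗ Id` and `σ(a) ⊗ Id`. -/
def tensorSum (ρ σ : OrthogonalRep r n) (m₁ m₂ : ℕ) :
    OrthogonalRep r ((n × Fin m₁) ⊕ (n × Fin m₂)) where
  toAlgHom := AlgHom.ofLinearMap
    { toFun := fun a => Matrix.fromBlocks
        (ρ.toAlgHom a ⊗ₖ (1 : Matrix (Fin m₁) (Fin m₁) ℝ)) 0
        0 (σ.toAlgHom a ⊗ₖ (1 : Matrix (Fin m₂) (Fin m₂) ℝ))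
      map_add' := fun a b => by
        simp [Matrix.fromBlocks_add, Matrix.add_kronecker]
      map_smul' := fun c a => by
        simp [Matrix.fromBlocks_smul, Matrix.smul_kronecker] }
    (by simp)
    (fun a b => by
      simp [Matrix.fromBlocks_multiply, ← Matrix.mul_kronecker_mul])
  skew := fun i j h => by
    have h₁ := ρ.skew i j h
    have h₂ := σ.skew i j h
    have key : ∀ (A : Matrix n n ℝ) (m : ℕ), Aᵀ = -A →
        (A ⊗ₖ (1 : Matrix (Fin m) (Fin m) ℝ))ᵀ = -(A ⊗ₖ (1 : Matrix (Fin m) (Fin m) ℝ)) := by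
      intro A m hA
      rw [← Matrix.kroneckerMap_transpose, hA, Matrix.transpose_one]
      ext a b
      simp
    simp [Matrix.fromBlocks_transpose, Matrix.fromBlocks_neg, key _ _ h₁, key _ _ h₂]

theorem mem_so (ρ : OrthogonalRep r n) (x : spin r) :
    ρ.toAlgHom (x : EvenClifford r) ∈ LieAlgebra.Orthogonal.so n ℝ := by
  obtain ⟨x, hx⟩ := x
  change x ∈ bivectorSpan r at hx
  change ρ.toAlgHom x ∈ LieAlgebra.Orthogonal.so n ℝ
  induction hx using Submodule.span_induction with
  | mem x hx =>
    obtain ⟨i, j, hij, rfl⟩ := hx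
    exact (LieAlgebra.Orthogonal.mem_so n ℝ _).2 (ρ.skew i j hij.ne)
  | zero => rw [map_zero]; exact zero_mem _
  | add x y _ _ hx hy => rw [map_add]; exact add_mem hx hy
  | smul c x _ hx => rw [map_smul]; exact (LieAlgebra.Orthogonal.so n ℝ).smul_mem c hx

/-- The restriction of the representation to `spin(r)`, as a homomorphism of real Lie algebras
`spin(r) → so(n)`. -/
def spinHom (ρ : OrthogonalRep r n) : spin r →ₗ⁅ℝ⁆ LieAlgebra.Orthogonal.so n ℝ where
  toFun x := ⟨ρ.toAlgHom (x : EvenClifford r), ρ.mem_so x⟩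
  map_add' x y := Subtype.ext (by simp)
  map_smul' c x := Subtype.ext (by simp)
  map_lie' := by
    intro x y
    apply Subtype.ext
    simp [Ring.lie_def]

end OrthogonalRep

/-- The centralizer of a Lie subalgebra `H` in a Lie algebra `L`. -/
def centralizer {L : Type} [LieRing L] [LieAlgebra ℝ L] (H : LieSubalgebra ℝ L) :
    LieSubalgebra ℝ L where
  carrier := {x | ∀ y ∈ H, ⁅x, y⁆ = 0}
  add_mem' := fun {a b} ha hb y hy => by rw [add_lie, ha y hy, hb y hy, add_zero]
  zero_mem' := fun y _ => zero_lie y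
  smul_mem' := fun c x hx y hy => by rw [smul_lie, hx y hy, smul_zero]
  lie_mem' := fun {a b} ha hb y hy => by
    rw [lie_lie, hb y hy, ha y hy, lie_zero, lie_zero, sub_zero]

/-- The compact symplectic Lie algebra `sp(m)`: quaternionic `m × m` matrices `A` with `A* = -A`,
a real Lie algebra under the commutator. -/
def sp (m : ℕ) : LieSubalgebra ℝ (Matrix (Fin m) (Fin m) ℍ[ℝ]) where
  carrier := {A | Aᴴ = -A}
  add_mem' := fun {A B} hA hB => by
    change Aᴴ = -A at hA
    change Bᴴ = -B at hB
    change (A + B)ᴴ = -(A + B)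
    rw [Matrix.conjTranspose_add, hA, hB]
    abel
  zero_mem' := by simp
  smul_mem' := fun c A hA => by
    change Aᴴ = -A at hA
    change (c • A)ᴴ = -(c • A)
    rw [← smul_neg, ← hA]
    refine Matrix.ext fun i j => ?_
    exact Quaternion.star_smul c (A j i)
  lie_mem' := fun {A B} hA hB => by
    change Aᴴ = -A at hA
    change Bᴴ = -B at hB
    change ⁅A, B⁆ᴴ = -⁅A, B⁆
    rw [Ring.lie_def, Matrix.conjTranspose_sub, Matrix.conjTranspose_mul,
      Matrix.conjTranspose_mul, hA, hB]
    noncomm_ring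

end

end SpinCentralizer

open SpinCentralizer

/-!
Since the bivectors generate `Cl_r⁰`, a matrix centralizes the image of `spin(r)` exactly if it
commutes with all of `Cl_r⁰` (`commute_map_of_forall_bivector`). Cut such a matrix on
`Δ⁺ ⊗ ℝ^{m₁} ⊕ Δ⁻ ⊗ ℝ^{m₂}` into `d × d` blocks: every block is an intertwining matrix, so by Schur's
lemma the mixed ones vanish and the others lie in the commutants of `Δ⁺` and `Δ⁻`. If both
commutants are identified, as algebras with transposition as involution, with a star algebra `R`,
the antisymmetric matrices among these are the skew-Hermitian matrices over `R`
(`OrthogonalRep.nonempty_centralizer_lieEquiv`).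

It remains to see that the commutant `D` of an irreducible representation is `ℝ` for `r ≡ 0 mod 8`
and `ℍ` for `r ≡ 4 mod 8`. As bivectors act by skew matrices, `D` is stable under transposition, and
symmetric elements of `D` are scalars because they have real eigenvalues. So transposition, as an
operator on `D`, has trace `2 - dim D`. This trace is also computed by averaging, as for the
Frobenius–Schur indicator: the `r - 1` elements `eᵢ e₀` are anticommuting square roots of `-1` that
generate `Cl_r⁰`, conjugating with all ordered products `b` of them and averaging projects onto
`D`, and so `2 - dim D` has the sign of `∑ tr (b²)`. The sum of the `b²` is `Re (1 + i) ^ r`, which is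
`(-4) ^ (r / 4)` (`OrthogonalRep.re_mul_card_eq`). Hence `dim D < 2` for `r ≡ 0 mod 8`, and `D = ℝ`;
for `r ≡ 4 mod 8` one has `dim D > 2`, and Frobenius' argument gives two anticommuting skew complex
structures `J`, `K` in `D` such that `1`, `J`, `K`, `J K` span `D`.
-/

namespace SpinCentralizer

/-! ### Averaging over products of anticommuting matrices -/

section Averaging

variable {n : Type} [Fintype n] [DecidableEq n]

/-- The linear operator `X ↦ A X Aᵀ` on square matrices. -/
noncomputable def conj (A : Matrix n n ℝ) : Module.End ℝ (Matrix n n ℝ) :=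
  LinearMap.mulLeft ℝ A * LinearMap.mulRight ℝ Aᵀ

theorem conj_apply (A X : Matrix n n ℝ) : conj A X = A * X * Aᵀ := by
  simp [conj, mul_assoc]

theorem conj_one : conj (1 : Matrix n n ℝ) = 1 := by
  ext1 X
  simp [conj_apply]

theorem conj_mul (A B : Matrix n n ℝ) : conj (A * B) = conj A * conj B := by
  ext1 X
  simp [conj_apply, Matrix.mul_assoc]

theorem conj_neg (A : Matrix n n ℝ) : conj (-A) = conj A := by
  ext1 X
  simp [conj_apply]

theorem trace_conj_comp_transpose (A : Matrix n n ℝ) :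
    LinearMap.trace ℝ _ (conj A ∘ₗ (Matrix.transposeLinearEquiv n n ℝ ℝ).toLinearMap) =
      (A * A).trace := by
  rw [LinearMap.trace_eq_matrix_trace ℝ (Matrix.stdBasis ℝ n n), Matrix.trace,
    Fintype.sum_prod_type, Matrix.trace]
  refine Finset.sum_congr rfl fun i _ => ?_
  rw [Matrix.diag_apply, Matrix.mul_apply]
  refine Finset.sum_congr rfl fun j _ => ?_
  rw [Matrix.diag_apply, LinearMap.toMatrix_apply, Matrix.stdBasis_eq_single]
  have h : ∀ X : Matrix n n ℝ, (Matrix.stdBasis ℝ n n).repr X (i, j) = X i j := fun X => by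
    simp [Matrix.stdBasis]
  rw [h]
  simp [conj_apply, Matrix.mul_apply, Matrix.single_apply, ite_and]

/-- The sum of the operators `X ↦ b X bᵀ` over all ordered products `b` of sublists of `l`. If `l`
consists of anticommuting orthogonal complex structures, this is, up to a positive factor, the
average over the finite group that they generate. -/
noncomputable def avg (l : List (Matrix n n ℝ)) : Module.End ℝ (Matrix n n ℝ) :=
  (l.sublists'.map fun I => conj I.prod).sum

theorem avg_nil : avg ([] : List (Matrix n n ℝ)) = 1 := by
  simp [avg, conj_one]

theorem avg_cons (b : Matrix n n ℝ) (l : List (Matrix n n ℝ)) :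
    avg (b :: l) = avg l + conj b * avg l := by
  simp [avg, List.sublists'_cons, Function.comp_def, conj_mul, List.sum_map_mul_left]

/-- The image of `avg l` is fixed by conjugation with the members of `l`. -/
theorem conj_mul_avg {l : List (Matrix n n ℝ)} (hl : l.Pairwise fun a b => a * b = -(b * a))
    (hsq : ∀ b ∈ l, b * b = -1) {b : Matrix n n ℝ} (hb : b ∈ l) : conj b * avg l = avg l := by
  induction l with
  | nil => simp at hb
  | cons c l ih =>
    rw [List.pairwise_cons] at hl
    rw [avg_cons, mul_add, ← mul_assoc, ← conj_mul]
    rcases List.mem_cons.1 hb with rfl | hb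
    · rw [hsq b (by simp), conj_neg, conj_one, one_mul, add_comm]
    · have ih' := ih hl.2 (fun b hb => hsq b (by simp [hb])) hb
      have hcb : b * c = -(c * b) := by rw [hl.1 b hb, neg_neg]
      rw [hcb, conj_neg, conj_mul, mul_assoc, ih']

/-- On matrices commuting with the members of `l`, `avg l` is multiplication by the number of
sublists. -/
theorem avg_apply_of_commute {l : List (Matrix n n ℝ)} (horth : ∀ b ∈ l, b * bᵀ = 1)
    {X : Matrix n n ℝ} (hX : ∀ b ∈ l, b * X = X * b) : avg l X = (2 : ℝ) ^ l.length • X := by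
  induction l with
  | nil => simp [avg_nil]
  | cons c l ih =>
    rw [avg_cons, LinearMap.add_apply, Module.End.mul_apply,
      ih (fun b hb => horth b (by simp [hb])) (fun b hb => hX b (by simp [hb])), map_smul,
      conj_apply, hX c (by simp), mul_assoc, horth c (by simp), mul_one, ← add_smul,
      List.length_cons, pow_succ]
    congr 1
    ring

theorem mul_prod_of_anticommute {b : Matrix n n ℝ} {I : List (Matrix n n ℝ)}
    (h : ∀ c ∈ I, b * c = -(c * b)) : I.prod * b = (-1 : ℝ) ^ I.length • (b * I.prod) := by
  induction I with
  | nil => simp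
  | cons c I ih =>
    have h' := h c (by simp)
    rw [List.prod_cons, mul_assoc, ih fun c hc => h c (by simp [hc]), mul_smul_comm, ← mul_assoc,
      ← mul_assoc, h', List.length_cons, pow_succ]
    simp

/-- The sums of the squares of all products of sublists of `k` anticommuting square roots of `-1`,
without and with the sign given by the parity of the sublist, are the real and the imaginary part
of `(1 + i) ^ (k + 1)`: adding one more factor multiplies the pair by `1 + i`. -/
theorem sum_sq_prod {l : List (Matrix n n ℝ)} (hl : l.Pairwise fun a b => a * b = -(b * a))
    (hsq : ∀ b ∈ l, b * b = -1) :
    (l.sublists'.map fun I => I.prod * I.prod).sum =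
        ((1 + Complex.I) ^ (l.length + 1)).re • (1 : Matrix n n ℝ) ∧
      (l.sublists'.map fun I => (-1 : ℝ) ^ I.length • (I.prod * I.prod)).sum =
        ((1 + Complex.I) ^ (l.length + 1)).im • (1 : Matrix n n ℝ) := by
  induction l with
  | nil => simp
  | cons c l ih =>
    rw [List.pairwise_cons] at hl
    obtain ⟨ih₁, ih₂⟩ := ih hl.2 (fun b hb => hsq b (by simp [hb]))
    have key : ∀ I ∈ l.sublists', (c :: I).prod * (c :: I).prod =
        (-1 : ℝ) • ((-1 : ℝ) ^ I.length • (I.prod * I.prod)) := by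
      intro I hI
      have hI' := (List.mem_sublists'.1 hI).subset
      rw [List.prod_cons, mul_assoc, ← mul_assoc I.prod,
        mul_prod_of_anticommute fun b hb => hl.1 b (hI' hb), smul_mul_assoc, mul_smul_comm,
        mul_assoc c I.prod, ← mul_assoc c c, hsq c (by simp)]
      simp
    have key' : ∀ I ∈ l.sublists',
        (-1 : ℝ) ^ (c :: I).length • ((c :: I).prod * (c :: I).prod) = I.prod * I.prod := by
      intro I hI
      have h : (-1 : ℝ) ^ (c :: I).length * (-1 * (-1) ^ I.length) = 1 := by
        rw [List.length_cons, ← pow_succ', ← mul_pow]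
        norm_num
      rw [key I hI, smul_smul, smul_smul, mul_assoc, h, one_smul]
    have e₁ := congrArg List.sum (List.map_congr_left key)
    have e₂ := congrArg List.sum (List.map_congr_left key')
    rw [List.sublists'_cons, List.map_append, List.map_append, List.sum_append, List.sum_append,
      List.map_map, List.map_map, ih₁, ih₂]
    simp only [Function.comp_def]
    have e₃ : ∀ L : List (List (Matrix n n ℝ)),
        (L.map fun I => (-1 : ℝ) • ((-1 : ℝ) ^ I.length • (I.prod * I.prod))).sum =
          (-1 : ℝ) • (L.map fun I => (-1 : ℝ) ^ I.length • (I.prod * I.prod)).sum := by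
      intro L
      rw [List.smul_sum, List.map_map]
      rfl
    rw [e₁, e₂, e₃, ih₁, ih₂, List.length_cons, pow_succ _ (l.length + 1), Complex.mul_re,
      Complex.mul_im]
    simp only [Complex.add_re, Complex.add_im, Complex.one_re, Complex.one_im, Complex.I_re,
      Complex.I_im]
    constructor <;> module

theorem one_add_I_pow_four_mul_re (k : ℕ) : ((1 + Complex.I) ^ (4 * k)).re = (-4) ^ k := by
  have h : (1 + Complex.I) ^ 4 = ((-4 : ℝ) : ℂ) := by
    have h2 : (1 + Complex.I) ^ 2 = 2 * Complex.I := by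
      linear_combination Complex.I_sq
    rw [show 4 = 2 * 2 by norm_num, pow_mul, h2, mul_pow, Complex.I_sq]
    norm_num
  rw [pow_mul, h, ← Complex.ofReal_pow, Complex.ofReal_re]

/-- The trace of `X ↦ avg l Xᵀ`: the numerator of a Frobenius–Schur indicator. -/
theorem trace_avg_comp_transpose {l : List (Matrix n n ℝ)}
    (hl : l.Pairwise fun a b => a * b = -(b * a)) (hsq : ∀ b ∈ l, b * b = -1) :
    LinearMap.trace ℝ _ (avg l ∘ₗ (Matrix.transposeLinearEquiv n n ℝ ℝ).toLinearMap) =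
      ((1 + Complex.I) ^ (l.length + 1)).re * Fintype.card n := by
  have h : ∀ L : List (List (Matrix n n ℝ)),
      LinearMap.trace ℝ _ ((L.map fun I : List (Matrix n n ℝ) => conj I.prod).sum ∘ₗ
        (Matrix.transposeLinearEquiv n n ℝ ℝ).toLinearMap) =
      ((L.map fun I : List (Matrix n n ℝ) => I.prod * I.prod).sum).trace := by
    intro L
    induction L with
    | nil => simp
    | cons I L ih =>
      rw [List.map_cons, List.sum_cons, LinearMap.add_comp, map_add, ih,
        trace_conj_comp_transpose, List.map_cons, List.sum_cons, Matrix.trace_add]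
  rw [avg, h, (sum_sq_prod hl hsq).1, Matrix.trace_smul, Matrix.trace_one, smul_eq_mul]

end Averaging

/-! ### The even Clifford algebra is generated by bivectors -/

theorem commute_map_of_forall_bivector {r : ℕ} {A : Type} [Ring A] [Algebra ℝ A]
    (f : EvenClifford r →ₐ[ℝ] A) {x : A} (h : ∀ i j, i ≠ j → Commute (f (bivector i j)) x)
    (a : EvenClifford r) : Commute (f a) x := by
  obtain ⟨a, ha⟩ := a
  induction a, ha using CliffordAlgebra.even_induction with
  | algebraMap c =>
    change Commute (f (algebraMap ℝ (EvenClifford r) c)) x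
    rw [AlgHom.commutes]
    exact Algebra.commutes c x
  | add a b ha hb iha ihb =>
    have := iha.add_left ihb
    rw [← map_add] at this
    exact this
  | ι_mul_ι_mul v w a ha ih =>
    have key : ∀ v w : Fin r → ℝ, (⟨CliffordAlgebra.ι (cliffordForm r) v *
        CliffordAlgebra.ι (cliffordForm r) w,
        CliffordAlgebra.ι_mul_ι_mem_evenOdd_zero _ _ _⟩ : EvenClifford r) =
        ∑ i, ∑ j, (v i * w j) • bivector i j := by
      intro v w
      apply Subtype.ext
      have hg : ∀ v : Fin r → ℝ, CliffordAlgebra.ι (cliffordForm r) v = ∑ i, v i • gen i := by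
        intro v
        conv_lhs => rw [pi_eq_sum_univ' v]
        simp [gen, map_sum]
      have hs : ((∑ i, ∑ j, (v i * w j) • bivector i j : EvenClifford r) :
          CliffordAlgebra (cliffordForm r)) = ∑ i, ∑ j, (v i * w j) • (gen i * gen j) := by
        rw [← Subalgebra.val_apply]
        simp only [map_sum, map_smul]
        rfl
      refine Eq.trans ?_ hs.symm
      change CliffordAlgebra.ι (cliffordForm r) v * CliffordAlgebra.ι (cliffordForm r) w = _
      rw [hg, hg, Finset.sum_mul_sum]
      simp [smul_smul, mul_comm]
    have h₂ : Commute (f ⟨CliffordAlgebra.ι (cliffordForm r) v *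
        CliffordAlgebra.ι (cliffordForm r) w,
        CliffordAlgebra.ι_mul_ι_mem_evenOdd_zero _ _ _⟩) x := by
      rw [key, map_sum]
      refine Commute.sum_left _ _ _ fun i _ => ?_
      rw [map_sum]
      refine Commute.sum_left _ _ _ fun j _ => ?_
      rw [map_smul]
      refine Commute.smul_left ?_ _
      by_cases hij : i = j
      · rw [← hij, bivector_mul_self, map_neg, map_one]
        exact (Commute.one_left x).neg_left
      · exact h i j hij
    have := h₂.mul_left ih
    rw [← map_mul] at this
    exact this

/-- It is enough to test commutation on the bivectors `eᵢ e₀`, since `eᵢ eⱼ = (eᵢ e₀) (eⱼ e₀)`. -/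
theorem commute_map_of_forall_bivector_pivot {k : ℕ} {A : Type} [Ring A] [Algebra ℝ A]
    (f : EvenClifford (k + 1) →ₐ[ℝ] A) {x : A}
    (h : ∀ i : Fin k, Commute (f (bivector i.succ 0)) x) (a : EvenClifford (k + 1)) :
    Commute (f a) x := by
  have h' : ∀ i, Commute (f (bivector i 0)) x := by
    intro i
    cases i using Fin.cases with
    | zero =>
      rw [bivector_mul_self, map_neg, map_one]
      exact (Commute.one_left x).neg_left
    | succ i => exact h i
  refine commute_map_of_forall_bivector f (fun i j hij => ?_) a
  by_cases hj : j = 0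
  · rw [hj]; exact h' i
  · have := bivector_mul_bivector i 0 j
    rw [bivector_swap hj, mul_neg, neg_inj] at this
    rw [← this, map_mul]
    exact (h' i).mul_left (h' j)

theorem bivector_pivot_anticommute {k : ℕ} {i j : Fin k} (h : i ≠ j) :
    (bivector i.succ 0 : EvenClifford (k + 1)) * bivector j.succ 0 =
      -(bivector j.succ 0 * bivector i.succ 0) := by
  have hs : i.succ ≠ j.succ := fun e => h (Fin.succ_injective _ e)
  have h₁ := bivector_mul_bivector i.succ 0 j.succ
  have h₂ := bivector_mul_bivector j.succ 0 i.succ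
  rw [bivector_swap (Fin.succ_ne_zero j), mul_neg, neg_inj] at h₁
  rw [bivector_swap (Fin.succ_ne_zero i), mul_neg, neg_inj] at h₂
  rw [h₁, h₂, bivector_swap hs, neg_neg]

theorem bivector_pivot_sq {k : ℕ} (i : Fin k) :
    (bivector i.succ 0 : EvenClifford (k + 1)) * bivector i.succ 0 = -1 := by
  have h₁ := bivector_mul_bivector i.succ 0 i.succ
  rwa [bivector_swap (Fin.succ_ne_zero i), mul_neg, neg_inj, bivector_mul_self] at h₁

namespace OrthogonalRep

/-! ### The commutant of an irreducible representation -/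

section Commutant

variable {r : ℕ} {n : Type} [Fintype n] [DecidableEq n]

/-- The algebra of real matrices commuting with the image of `Cl_r⁰`. -/
def commutant (ρ : OrthogonalRep r n) : Subalgebra ℝ (Matrix n n ℝ) :=
  Subalgebra.centralizer ℝ (Set.range ρ.toAlgHom)

theorem mem_commutant {ρ : OrthogonalRep r n} {X : Matrix n n ℝ} :
    X ∈ ρ.commutant ↔ ∀ a, ρ.toAlgHom a * X = X * ρ.toAlgHom a := by
  rw [commutant, Subalgebra.mem_centralizer_iff, Set.forall_mem_range]

theorem mem_commutant_iff_bivector {ρ : OrthogonalRep r n} {X : Matrix n n ℝ} :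
    X ∈ ρ.commutant ↔
      ∀ i j, i ≠ j → ρ.toAlgHom (bivector i j) * X = X * ρ.toAlgHom (bivector i j) :=
  ⟨fun h _ _ _ => mem_commutant.1 h _,
    fun h => mem_commutant.2 (commute_map_of_forall_bivector ρ.toAlgHom h)⟩

theorem transpose_mem_commutant {ρ : OrthogonalRep r n} {X : Matrix n n ℝ}
    (hX : X ∈ ρ.commutant) : Xᵀ ∈ ρ.commutant := by
  rw [mem_commutant_iff_bivector] at hX ⊢
  intro i j hij
  have h := congrArg Matrix.transpose (hX i j hij)
  rw [Matrix.transpose_mul, Matrix.transpose_mul, ρ.skew i j hij, mul_neg, neg_mul, neg_inj] at h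
  exact h.symm

/-- Schur's lemma: an intertwining matrix from an irreducible representation with nonzero kernel
vanishes. -/
theorem eq_zero_of_intertwining {ρ σ : OrthogonalRep r n} (hρ : ρ.IsIrreducible)
    {Y : Matrix n n ℝ} (hY : ∀ a, Y * ρ.toAlgHom a = σ.toAlgHom a * Y)
    {v : n → ℝ} (hv : v ≠ 0) (hYv : Y *ᵥ v = 0) : Y = 0 := by
  rcases hρ.2 (LinearMap.ker Y.mulVecLin) fun a w hw => by
    rw [LinearMap.mem_ker, Matrix.mulVecLin_apply] at hw ⊢
    rw [Matrix.mulVec_mulVec, hY, ← Matrix.mulVec_mulVec, hw, Matrix.mulVec_zero] with h | h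
  · have : v ∈ LinearMap.ker Y.mulVecLin := hYv
    rw [h] at this
    exact absurd this hv
  · refine Matrix.ext_of_mulVec_single fun i => ?_
    have : (Pi.single i 1 : n → ℝ) ∈ LinearMap.ker Y.mulVecLin := by rw [h]; trivial
    rw [Matrix.zero_mulVec]
    exact this

theorem eq_zero_of_intertwining_of_not_equivalent {ρ σ : OrthogonalRep r n}
    (hρ : ρ.IsIrreducible) (h : ¬ ρ.Equivalent σ) {Y : Matrix n n ℝ}
    (hY : ∀ a, Y * ρ.toAlgHom a = σ.toAlgHom a * Y) : Y = 0 := by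
  by_contra hne
  have hinj : Function.Injective Y.mulVec := by
    change Function.Injective Y.mulVecLin
    refine LinearMap.ker_eq_bot.1 ((Submodule.eq_bot_iff _).2 fun v hv => ?_)
    by_contra hv0
    exact hne (eq_zero_of_intertwining hρ hY hv0 hv)
  obtain ⟨P, hP⟩ := Matrix.mulVec_injective_iff_isUnit.1 hinj
  exact h ⟨P, fun a => by rw [hP]; exact hY a⟩

theorem exists_eq_smul_one_of_transpose_eq {ρ : OrthogonalRep r n} (hρ : ρ.IsIrreducible)
    {X : Matrix n n ℝ} (hX : X ∈ ρ.commutant) (hs : Xᵀ = X) : ∃ c : ℝ, X = c • 1 := by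
  obtain ⟨i⟩ := hρ.1
  have hH : X.IsHermitian := by
    rw [Matrix.IsHermitian, Matrix.conjTranspose_eq_transpose_of_trivial, hs]
  refine ⟨hH.eigenvalues i, sub_eq_zero.1 (eq_zero_of_intertwining (σ := ρ) hρ (fun a => ?_)
    (v := hH.eigenvectorBasis i) ?_ ?_)⟩
  · rw [sub_mul, mul_sub, mem_commutant.1 hX]
    simp
  · intro h0
    exact hH.eigenvectorBasis.toBasis.ne_zero i (by
      rw [OrthonormalBasis.coe_toBasis]
      ext j
      exact congrFun h0 j)
  · rw [Matrix.sub_mulVec, hH.mulVec_eigenvectorBasis, Matrix.smul_mulVec, Matrix.one_mulVec,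
      sub_self]

theorem transpose_eq_of_mem_commutant {ρ : OrthogonalRep r n} (hρ : ρ.IsIrreducible)
    {X : Matrix n n ℝ} (hX : X ∈ ρ.commutant) :
    Xᵀ = (2 * (X.trace / Fintype.card n)) • (1 : Matrix n n ℝ) - X := by
  obtain ⟨c, hc⟩ := exists_eq_smul_one_of_transpose_eq hρ
    (add_mem hX (transpose_mem_commutant hX))
    (by rw [Matrix.transpose_add, Matrix.transpose_transpose, add_comm])
  have hd : (Fintype.card n : ℝ) ≠ 0 := by
    have := hρ.1
    exact_mod_cast Fintype.card_ne_zero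
  have ht := congrArg Matrix.trace hc
  rw [Matrix.trace_add, Matrix.trace_transpose, Matrix.trace_smul, Matrix.trace_one,
    smul_eq_mul] at ht
  have : 2 * (X.trace / Fintype.card n) = c := by field_simp; linarith
  rw [this, ← hc, add_sub_cancel_left]

/-- The Frobenius–Schur count. Transposition acts on the commutant as the identity on a line of
scalars and as `-1` on the skew part, so that its trace is `2 - dim`; by averaging, this trace is
also determined by the squares of the products of the generators. -/
theorem re_mul_card_eq {ρ : OrthogonalRep r n} (hρ : ρ.IsIrreducible) {l : List (Matrix n n ℝ)}
    (hl : l.Pairwise fun a b => a * b = -(b * a)) (hsq : ∀ b ∈ l, b * b = -1)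
    (hsk : ∀ b ∈ l, bᵀ = -b)
    (hD : ∀ X : Matrix n n ℝ, X ∈ ρ.commutant ↔ ∀ b ∈ l, b * X = X * b) :
    ((1 + Complex.I) ^ (l.length + 1)).re * Fintype.card n =
      2 ^ l.length * (2 - Module.finrank ℝ ρ.commutant) := by
  have horth : ∀ b ∈ l, b * bᵀ = 1 := fun b hb => by rw [hsk b hb, mul_neg, hsq b hb, neg_neg]
  have horth' : ∀ b ∈ l, bᵀ * b = 1 := fun b hb => by rw [hsk b hb, neg_mul, hsq b hb, neg_neg]
  have hd : (Fintype.card n : ℝ) ≠ 0 := by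
    have := hρ.1
    exact_mod_cast Fintype.card_ne_zero
  set T := avg l ∘ₗ (Matrix.transposeLinearEquiv n n ℝ ℝ).toLinearMap with hT
  have hmem : ∀ X, T X ∈ Subalgebra.toSubmodule ρ.commutant := by
    intro X
    rw [Subalgebra.mem_toSubmodule, hD]
    intro b hb
    have h := LinearMap.congr_fun (conj_mul_avg hl hsq hb) Xᵀ
    rw [Module.End.mul_apply, conj_apply] at h
    change b * avg l Xᵀ = avg l Xᵀ * b
    conv_rhs => rw [← h]
    rw [mul_assoc (b * avg l Xᵀ), horth' b hb, mul_one]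
  rw [← trace_avg_comp_transpose hl hsq, ← hT,
    ← LinearMap.trace_restrict_eq_of_forall_mem _ T hmem]
  set g : Subalgebra.toSubmodule ρ.commutant →ₗ[ℝ] ℝ :=
    ((Fintype.card n : ℝ)⁻¹ • Matrix.traceLinearMap n ℝ ℝ) ∘ₗ Submodule.subtype _ with hg
  have hone : (1 : Matrix n n ℝ) ∈ Subalgebra.toSubmodule ρ.commutant := one_mem ρ.commutant
  have hres : T.restrict (fun x _ => hmem x) = (2 : ℝ) ^ l.length • ((2 : ℝ) •
      g.smulRight (⟨1, hone⟩ : Subalgebra.toSubmodule ρ.commutant) + (-1 : ℝ) • LinearMap.id) := by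
    ext1 ⟨X, hX⟩
    apply Subtype.ext
    have hX' : X ∈ ρ.commutant := hX
    change avg l Xᵀ = (2 : ℝ) ^ l.length • ((2 : ℝ) • (((Fintype.card n : ℝ)⁻¹ • X.trace) •
      (1 : Matrix n n ℝ)) + (-1 : ℝ) • X)
    rw [avg_apply_of_commute horth ((hD _).1 (transpose_mem_commutant hX')),
      transpose_eq_of_mem_commutant hρ hX', smul_smul, smul_eq_mul, div_eq_inv_mul,
      neg_one_smul, ← sub_eq_add_neg]
  rw [hres, map_smul, map_add, map_smul, map_smul, LinearMap.trace_smulRight, LinearMap.trace_id]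
  have : g ⟨1, hone⟩ = 1 := by
    simp [hg, hd]
  rw [this, smul_eq_mul, smul_eq_mul, mul_one, smul_eq_mul, neg_one_mul, ← sub_eq_add_neg]
  rfl

/-- The sign of `2 - dim` of the commutant is that of the real part of `(1 + i) ^ r`. -/
theorem exists_re_mul_eq_two_sub_finrank {ρ : OrthogonalRep r n} (hρ : ρ.IsIrreducible) :
    ∃ c : ℝ, 0 < c ∧
      ((1 + Complex.I) ^ r).re * c = 2 - Module.finrank ℝ ρ.commutant := by
  have := hρ.1
  have hd : (0 : ℝ) < Fintype.card n := by exact_mod_cast Fintype.card_pos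
  cases r with
  | zero =>
    -- Every matrix commutes with the scalars `Cl_0⁰`, and no generators are needed.
    have := re_mul_card_eq hρ (l := []) List.Pairwise.nil (by simp) (by simp) (fun X => by
      simp only [List.not_mem_nil, false_implies, implies_true, iff_true]
      rw [mem_commutant_iff_bivector]
      exact fun i => i.elim0)
    exact ⟨Fintype.card n, hd, by simpa using this⟩
  | succ k =>
    refine ⟨Fintype.card n / 2 ^ k, by positivity, ?_⟩
    have := re_mul_card_eq hρ
      (l := List.ofFn fun i : Fin k => ρ.toAlgHom (bivector i.succ 0)) ?_ ?_ ?_ ?_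
    · rw [List.length_ofFn] at this
      rw [← mul_div_assoc, this, mul_div_cancel_left₀ _ (by positivity)]
    · rw [List.pairwise_ofFn]
      intro i j hij
      rw [← map_mul, ← map_mul, ← map_neg, bivector_pivot_anticommute hij.ne]
    · intro b hb
      obtain ⟨i, rfl⟩ := List.mem_ofFn.1 hb
      rw [← map_mul, bivector_pivot_sq, map_neg, map_one]
    · intro b hb
      obtain ⟨i, rfl⟩ := List.mem_ofFn.1 hb
      exact ρ.skew _ _ (Fin.succ_ne_zero i)
    · intro X
      simp only [List.forall_mem_ofFn_iff]
      exact ⟨fun h i => mem_commutant.1 h _,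
        fun h => mem_commutant.2 (commute_map_of_forall_bivector_pivot ρ.toAlgHom h)⟩

theorem finrank_commutant_lt_two {ρ : OrthogonalRep r n} (hρ : ρ.IsIrreducible) (hr : r % 8 = 0) :
    Module.finrank ℝ ρ.commutant < 2 := by
  obtain ⟨c, hc, h⟩ := exists_re_mul_eq_two_sub_finrank hρ
  have hre : ((1 + Complex.I) ^ r).re = ((-4) ^ 2) ^ (r / 8) := by
    rw [← pow_mul, ← one_add_I_pow_four_mul_re, show 4 * (2 * (r / 8)) = r by omega]
  have h2 : (0 : ℝ) < 2 - Module.finrank ℝ ρ.commutant := by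
    rw [← h, hre]
    positivity
  exact_mod_cast sub_pos.1 h2

theorem two_lt_finrank_commutant {ρ : OrthogonalRep r n} (hρ : ρ.IsIrreducible) (hr : r % 8 = 4) :
    2 < Module.finrank ℝ ρ.commutant := by
  obtain ⟨c, hc, h⟩ := exists_re_mul_eq_two_sub_finrank hρ
  have hre : ((1 + Complex.I) ^ r).re = -(((-4) ^ 2) ^ (r / 8) * 4) := by
    rw [← pow_mul, ← mul_neg, ← pow_succ, ← one_add_I_pow_four_mul_re,
      show 4 * (2 * (r / 8) + 1) = r by omega]
  have h2 : (0 : ℝ) < Module.finrank ℝ ρ.commutant - 2 := by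
    rw [← neg_sub, ← h, hre, neg_mul, neg_neg]
    positivity
  exact_mod_cast sub_pos.1 h2

/-- For `r ≡ 0 mod 8` an irreducible representation is of real type: its commutant is `ℝ`. -/
theorem exists_starAlgHom_real {ρ : OrthogonalRep r n} (hρ : ρ.IsIrreducible) (hr : r % 8 = 0) :
    ∃ φ : ℝ →⋆ₐ[ℝ] Matrix n n ℝ, ∀ X, X ∈ ρ.commutant ↔ ∃ c, φ c = X := by
  have := hρ.1
  have h1 : Module.finrank ℝ ρ.commutant = 1 := by
    have h0 : 0 < Module.finrank ℝ ρ.commutant := Module.finrank_pos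
    have := finrank_commutant_lt_two hρ hr
    omega
  refine ⟨StarAlgHom.ofId ℝ _, fun X => ?_⟩
  rw [Subalgebra.eq_bot_of_finrank_one h1, Algebra.mem_bot]
  rfl

/-- A nonzero skew element of the commutant is, up to a real factor, a complex structure: its
square is a symmetric element, hence a scalar, and it is negative. -/
theorem exists_smul_mul_smul_eq_neg_one {ρ : OrthogonalRep r n} (hρ : ρ.IsIrreducible)
    {Z : Matrix n n ℝ} (hZ : Z ∈ ρ.commutant) (hs : Zᵀ = -Z) (h0 : Z ≠ 0) :
    ∃ t : ℝ, t ≠ 0 ∧ (t • Z) * (t • Z) = -1 := by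
  obtain ⟨i⟩ := hρ.1
  obtain ⟨c, hc⟩ := exists_eq_smul_one_of_transpose_eq hρ (mul_mem hZ hZ)
    (by rw [Matrix.transpose_mul, hs, neg_mul_neg])
  have hdiag : ∀ j, ∑ k, Z k j * Z k j = -c := by
    intro j
    have h := congrFun (congrFun hc j) j
    rw [Matrix.mul_apply, Matrix.smul_apply, Matrix.one_apply_eq, smul_eq_mul, mul_one] at h
    rw [← h, ← Finset.sum_neg_distrib]
    refine Finset.sum_congr rfl fun k _ => ?_
    have hkj : Z k j = -Z j k := congrFun (congrFun hs j) k
    rw [hkj]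
    ring
  have hc0 : 0 < -c := by
    refine lt_of_le_of_ne (hdiag i ▸ Finset.sum_nonneg fun k _ => mul_self_nonneg _) ?_
    intro hc'
    apply h0
    ext k j
    have := (Finset.sum_eq_zero_iff_of_nonneg fun k _ => mul_self_nonneg (Z k j)).1
      ((hdiag j).trans hc'.symm) k (Finset.mem_univ k)
    simpa using this
  refine ⟨(√(-c))⁻¹, inv_ne_zero (Real.sqrt_pos.2 hc0).ne', ?_⟩
  rw [smul_mul_smul_comm, hc, smul_smul, ← mul_inv, Real.mul_self_sqrt hc0.le, inv_neg,
    neg_mul, inv_mul_cancel₀ (by linarith), neg_one_smul]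

theorem exists_anticommutator_eq_smul_one {ρ : OrthogonalRep r n} (hρ : ρ.IsIrreducible)
    {Y Z : Matrix n n ℝ} (hY : Y ∈ ρ.commutant) (hZ : Z ∈ ρ.commutant) (hYs : Yᵀ = -Y)
    (hZs : Zᵀ = -Z) : ∃ a : ℝ, Y * Z + Z * Y = (2 * a) • 1 := by
  obtain ⟨c, hc⟩ := exists_eq_smul_one_of_transpose_eq hρ
    (add_mem (mul_mem hY hZ) (mul_mem hZ hY)) (by
      rw [Matrix.transpose_add, Matrix.transpose_mul, Matrix.transpose_mul, hYs, hZs, neg_mul_neg,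
        neg_mul_neg, add_comm])
  exact ⟨c / 2, by rw [hc, mul_div_cancel₀ _ (two_ne_zero)]⟩

/-- Every element of the commutant is a scalar plus a skew element. -/
theorem exists_eq_smul_one_add_skew {ρ : OrthogonalRep r n} (hρ : ρ.IsIrreducible)
    {X : Matrix n n ℝ} (hX : X ∈ ρ.commutant) :
    ∃ (c : ℝ) (Z : Matrix n n ℝ), Z ∈ ρ.commutant ∧ Zᵀ = -Z ∧ X = c • 1 + Z := by
  have h := transpose_eq_of_mem_commutant hρ hX
  set c := X.trace / Fintype.card n
  refine ⟨c, X - c • 1, sub_mem hX (ρ.commutant.smul_mem (one_mem _) c), ?_, by abel⟩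
  rw [Matrix.transpose_sub, h, Matrix.transpose_smul, Matrix.transpose_one]
  module

/-- In dimension greater than two the commutant contains two anticommuting skew complex
structures. -/
theorem exists_anticommuting_pair {ρ : OrthogonalRep r n} (hρ : ρ.IsIrreducible)
    (h2 : 2 < Module.finrank ℝ ρ.commutant) :
    ∃ J K : Matrix n n ℝ, J ∈ ρ.commutant ∧ K ∈ ρ.commutant ∧ Jᵀ = -J ∧ Kᵀ = -K ∧
      J * J = -1 ∧ K * K = -1 ∧ K * J = -(J * K) := by
  have hex : ∀ J : Matrix n n ℝ, ∃ X ∈ ρ.commutant, X ∉ Submodule.span ℝ {1, J} := by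
    intro J
    by_contra! hle
    have h := Submodule.finrank_mono
      (show Subalgebra.toSubmodule ρ.commutant ≤ Submodule.span ℝ {1, J} from hle)
    have h' := (finrank_span_le_card (R := ℝ) ({1, J} : Set (Matrix n n ℝ))).trans
      (by simpa using Finset.card_le_two)
    change Module.finrank ℝ ρ.commutant ≤ _ at h
    omega
  obtain ⟨J, hJ, hJs, hJJ⟩ : ∃ J ∈ ρ.commutant, Jᵀ = -J ∧ J * J = -1 := by
    obtain ⟨X, hX, hXn⟩ := hex 1
    obtain ⟨c, Z, hZ, hZs, rfl⟩ := exists_eq_smul_one_add_skew hρ hX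
    obtain ⟨t, -, ht⟩ := exists_smul_mul_smul_eq_neg_one hρ hZ hZs (by
      rintro rfl
      exact hXn (Submodule.mem_span_pair.2 ⟨c, 0, by simp⟩))
    exact ⟨t • Z, ρ.commutant.smul_mem hZ t, by rw [Matrix.transpose_smul, hZs, smul_neg], ht⟩
  obtain ⟨X, hX, hXn⟩ := hex J
  obtain ⟨c, Z, hZ, hZs, rfl⟩ := exists_eq_smul_one_add_skew hρ hX
  obtain ⟨a, ha⟩ := exists_anticommutator_eq_smul_one hρ hJ hZ hJs hZs
  -- `Z + a J` is the component of `Z` orthogonal to `J`.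
  have hW : Z + a • J ∈ ρ.commutant := add_mem hZ (ρ.commutant.smul_mem hJ a)
  have hWs : (Z + a • J)ᵀ = -(Z + a • J) := by
    rw [Matrix.transpose_add, Matrix.transpose_smul, hZs, hJs]
    module
  have hWJ : (Z + a • J) * J = -(J * (Z + a • J)) := by
    rw [add_mul, mul_add, smul_mul_assoc, mul_smul_comm, hJJ, eq_sub_of_add_eq' ha]
    module
  obtain ⟨t, -, ht⟩ := exists_smul_mul_smul_eq_neg_one hρ hW hWs (by
    intro h0
    exact hXn (Submodule.mem_span_pair.2 ⟨c, -a, by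
      rw [eq_neg_of_add_eq_zero_left h0, neg_smul]⟩))
  refine ⟨J, t • (Z + a • J), hJ, ρ.commutant.smul_mem hW t, hJs, ?_, hJJ, ht, ?_⟩
  · rw [Matrix.transpose_smul, hWs, smul_neg]
  · rw [smul_mul_assoc, hWJ, mul_smul_comm, smul_neg]

/-- A skew element of the commutant anticommuting with `J`, `K` and `J K` is zero, since it also
commutes with `J K`. Hence `1`, `J`, `K`, `J K` span the commutant. -/
theorem exists_eq_of_anticommuting_pair {ρ : OrthogonalRep r n} (hρ : ρ.IsIrreducible)
    {J K : Matrix n n ℝ} (hJ : J ∈ ρ.commutant) (hK : K ∈ ρ.commutant) (hJs : Jᵀ = -J)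
    (hKs : Kᵀ = -K) (hJJ : J * J = -1) (hKK : K * K = -1) (hKJ : K * J = -(J * K))
    {X : Matrix n n ℝ} (hX : X ∈ ρ.commutant) :
    ∃ c x y z : ℝ, X = c • 1 + x • J + y • K + z • (J * K) := by
  obtain ⟨c, Z, hZ, hZs, rfl⟩ := exists_eq_smul_one_add_skew hρ hX
  have hL := mul_mem hJ hK
  have hLs : (J * K)ᵀ = -(J * K) := by rw [Matrix.transpose_mul, hJs, hKs, neg_mul_neg, hKJ]
  obtain ⟨x, hx⟩ := exists_anticommutator_eq_smul_one hρ hJ hZ hJs hZs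
  obtain ⟨y, hy⟩ := exists_anticommutator_eq_smul_one hρ hK hZ hKs hZs
  obtain ⟨z, hz⟩ := exists_anticommutator_eq_smul_one hρ hL hZ hLs hZs
  have hJL : J * (J * K) = -K := by rw [← mul_assoc, hJJ, neg_one_mul]
  have hLJ : J * K * J = K := by rw [mul_assoc, hKJ, mul_neg, hJL, neg_neg]
  have hLK : J * K * K = -J := by rw [mul_assoc, hKK, mul_neg_one]
  have hKL : K * (J * K) = J := by rw [← mul_assoc, hKJ, neg_mul, hLK, neg_neg]
  have hLL : J * K * (J * K) = -1 := by rw [← mul_assoc, hLJ, hKK]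
  set W := Z + x • J + y • K + z • (J * K) with hW
  have hWJ : W * J = -(J * W) := by
    rw [hW]
    simp only [add_mul, mul_add, smul_mul_assoc, mul_smul_comm, hJJ, hKJ, hLJ, hJL,
      eq_sub_of_add_eq' hx]
    module
  have hWK : W * K = -(K * W) := by
    rw [hW]
    simp only [add_mul, mul_add, smul_mul_assoc, mul_smul_comm, hKK, hKJ, hLK, hKL,
      eq_sub_of_add_eq' hy]
    module
  have hWL : W * (J * K) = -(J * K * W) := by
    rw [hW]
    simp only [add_mul, mul_add, smul_mul_assoc, mul_smul_comm, hLJ, hJL, hLK, hKL, hLL,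
      eq_sub_of_add_eq' hz]
    module
  have hWL' : W * (J * K) = J * K * W := by
    rw [← mul_assoc, hWJ, neg_mul, mul_assoc, hWK, mul_neg, neg_neg, mul_assoc]
  have hLW : J * K * W = 0 := by
    have h : (2 : ℝ) • (J * K * W) = 0 := by
      rw [two_smul]
      nth_rewrite 1 [← hWL', hWL]
      exact neg_add_cancel _
    exact (smul_eq_zero.1 h).resolve_left two_ne_zero
  have hW0 : W = 0 := by
    have h := congrArg (J * K * ·) hLW
    simp only [← mul_assoc (J * K) (J * K), hLL, mul_zero, neg_one_mul] at h
    exact neg_eq_zero.1 h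
  refine ⟨c, -x, -y, -z, ?_⟩
  have hZ' : Z = W - x • J - y • K - z • (J * K) := by rw [hW]; abel
  rw [hZ', hW0]
  module

/-- For `r ≡ 4 mod 8` an irreducible representation is of quaternionic type: its commutant is `ℍ`,
with transposition as conjugation. -/
theorem exists_starAlgHom_quaternion {ρ : OrthogonalRep r n} (hρ : ρ.IsIrreducible)
    (hr : r % 8 = 4) :
    ∃ φ : ℍ[ℝ] →⋆ₐ[ℝ] Matrix n n ℝ, ∀ X, X ∈ ρ.commutant ↔ ∃ q, φ q = X := by
  obtain ⟨J, K, hJ, hK, hJs, hKs, hJJ, hKK, hKJ⟩ :=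
    exists_anticommuting_pair hρ (two_lt_finrank_commutant hρ hr)
  let B : QuaternionAlgebra.Basis (Matrix n n ℝ) (-1 : ℝ) 0 (-1) :=
    { i := J, j := K, k := J * K
      i_mul_i := by simp [hJJ]
      j_mul_j := by simp [hKK]
      i_mul_j := rfl
      j_mul_i := by simp [hKJ] }
  let f : ℍ[ℝ] →ₐ[ℝ] Matrix n n ℝ := B.liftHom
  have hf : ∀ q, f q = q.re • 1 + q.imI • J + q.imJ • K + q.imK • (J * K) := by
    intro q
    rw [← Algebra.algebraMap_eq_smul_one]
    rfl
  refine ⟨{ f with map_star' := fun q => ?_ }, fun X => ⟨fun hX => ?_, ?_⟩⟩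
  · change f (star q) = star (f q)
    rw [hf, hf, Matrix.star_eq_conjTranspose, Matrix.conjTranspose_eq_transpose_of_trivial]
    simp only [Matrix.transpose_add, Matrix.transpose_smul, Matrix.transpose_one,
      Matrix.transpose_mul, hJs, hKs, neg_mul_neg, hKJ, Quaternion.re_star, Quaternion.imI_star,
      Quaternion.imJ_star, Quaternion.imK_star]
    module
  · obtain ⟨c, x, y, z, rfl⟩ :=
      exists_eq_of_anticommuting_pair hρ hJ hK hJs hKs hJJ hKK hKJ hX
    exact ⟨⟨c, x, y, z⟩, hf _⟩
  · rintro ⟨q, rfl⟩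
    change f q ∈ ρ.commutant
    rw [hf]
    exact add_mem (add_mem (add_mem (ρ.commutant.smul_mem (one_mem _) _)
      (ρ.commutant.smul_mem hJ _)) (ρ.commutant.smul_mem hK _))
      (ρ.commutant.smul_mem (mul_mem hJ hK) _)

end Commutant

end OrthogonalRep

/-! ### The centralizer of the image of `spin(r)` -/

/-- A matrix intertwines `A ⊗ Id` and `B ⊗ Id` exactly if all its blocks intertwine `A` and `B`. -/
theorem kronecker_one_mul_eq_iff {n : Type} [Fintype n] {p q : ℕ} (A B : Matrix n n ℝ)
    (X : Matrix (n × Fin p) (n × Fin q) ℝ) :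
    (A ⊗ₖ (1 : Matrix (Fin p) (Fin p) ℝ)) * X = X * (B ⊗ₖ (1 : Matrix (Fin q) (Fin q) ℝ)) ↔
      ∀ i j, A * X.submatrix (fun a => (a, i)) (fun b => (b, j)) =
        X.submatrix (fun a => (a, i)) (fun b => (b, j)) * B := by
  have h₁ : ∀ a i b j, ((A ⊗ₖ (1 : Matrix (Fin p) (Fin p) ℝ)) * X) (a, i) (b, j) =
      (A * X.submatrix (fun a => (a, i)) (fun b => (b, j))) a b := by
    intro a i b j
    rw [Matrix.mul_apply, Matrix.mul_apply, Fintype.sum_prod_type]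
    refine Finset.sum_congr rfl fun c _ => ?_
    simp [Matrix.kroneckerMap_apply, Matrix.one_apply]
  have h₂ : ∀ a i b j, (X * (B ⊗ₖ (1 : Matrix (Fin q) (Fin q) ℝ))) (a, i) (b, j) =
      (X.submatrix (fun a => (a, i)) (fun b => (b, j)) * B) a b := by
    intro a i b j
    rw [Matrix.mul_apply, Matrix.mul_apply, Fintype.sum_prod_type]
    refine Finset.sum_congr rfl fun c _ => ?_
    simp [Matrix.kroneckerMap_apply, Matrix.one_apply]
  constructor
  · intro h i j
    ext a b
    rw [← h₁, ← h₂, h]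
  · intro h
    ext ⟨a, i⟩ ⟨b, j⟩
    rw [h₁, h₂, h]

section BlockEmbedding

variable {n R : Type} [Fintype n] [DecidableEq n] [Ring R] [StarRing R] [Algebra ℝ R]

/-- The map sending a matrix `A` over `R` to the real matrix obtained by replacing every entry by
its image under `φ`; the tensor factor on which `φ` acts comes first, as in `ρ(a) ⊗ Id`. -/
def blockEmbedding (φ : R →⋆ₐ[ℝ] Matrix n n ℝ) (m : ℕ) :
    Matrix (Fin m) (Fin m) R →ₗ[ℝ] Matrix (n × Fin m) (n × Fin m) ℝ where
  toFun A := Matrix.of fun p q => φ (A p.2 q.2) p.1 q.1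
  map_add' A B := by ext p q; simp
  map_smul' c A := by ext p q; simp

theorem blockEmbedding_apply (φ : R →⋆ₐ[ℝ] Matrix n n ℝ) {m : ℕ}
    (A : Matrix (Fin m) (Fin m) R) (p q : n × Fin m) :
    blockEmbedding φ m A p q = φ (A p.2 q.2) p.1 q.1 := rfl

theorem blockEmbedding_mul (φ : R →⋆ₐ[ℝ] Matrix n n ℝ) {m : ℕ}
    (A B : Matrix (Fin m) (Fin m) R) :
    blockEmbedding φ m (A * B) = blockEmbedding φ m A * blockEmbedding φ m B := by
  ext p q
  rw [blockEmbedding_apply, Matrix.mul_apply, Matrix.mul_apply, map_sum, Matrix.sum_apply,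
    Fintype.sum_prod_type_right]
  refine Finset.sum_congr rfl fun i _ => ?_
  rw [map_mul, Matrix.mul_apply]
  rfl

theorem blockEmbedding_conjTranspose (φ : R →⋆ₐ[ℝ] Matrix n n ℝ) {m : ℕ}
    (A : Matrix (Fin m) (Fin m) R) :
    blockEmbedding φ m Aᴴ = (blockEmbedding φ m A)ᵀ := by
  ext p q
  rw [blockEmbedding_apply, Matrix.conjTranspose_apply, map_star, Matrix.star_eq_conjTranspose,
    Matrix.conjTranspose_eq_transpose_of_trivial]
  rfl

theorem blockEmbedding_injective {φ : R →⋆ₐ[ℝ] Matrix n n ℝ} (hφ : Function.Injective φ) (m : ℕ) :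
    Function.Injective (blockEmbedding φ m) := by
  intro A B h
  ext i j
  refine hφ (Matrix.ext fun a b => ?_)
  exact congrFun (congrFun h (a, i)) (b, j)

end BlockEmbedding

namespace OrthogonalRep

variable {r : ℕ} {n : Type} [Fintype n] [DecidableEq n]

theorem mem_centralizer_spinHom_range_iff {ρ : OrthogonalRep r n}
    {x : LieAlgebra.Orthogonal.so n ℝ} :
    x ∈ centralizer ρ.spinHom.range ↔ (x : Matrix n n ℝ) ∈ ρ.commutant := by
  rw [mem_commutant_iff_bivector]
  constructor
  · intro h i j hij
    have := h _ ⟨⟨bivector i j, bivector_mem hij⟩, rfl⟩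
    have := congrArg Subtype.val this
    exact (sub_eq_zero.1 this).symm
  · rintro h _ ⟨y, rfl⟩
    refine Subtype.ext (sub_eq_zero.2 ?_)
    exact (commute_map_of_forall_bivector ρ.toAlgHom h y).symm

theorem tensorSum_toAlgHom_apply (ρ σ : OrthogonalRep r n) (m₁ m₂ : ℕ) (a : EvenClifford r) :
    (ρ.tensorSum σ m₁ m₂).toAlgHom a = Matrix.fromBlocks
      (ρ.toAlgHom a ⊗ₖ (1 : Matrix (Fin m₁) (Fin m₁) ℝ)) 0
      0 (σ.toAlgHom a ⊗ₖ (1 : Matrix (Fin m₂) (Fin m₂) ℝ)) := rfl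

/-- A block matrix commutes with `ρ ⊗ Id ⊕ σ ⊗ Id` exactly if its diagonal blocks have entries in the
commutants of `ρ` and `σ` and its off-diagonal blocks consist of intertwining matrices. -/
theorem fromBlocks_mem_commutant_tensorSum_iff {ρ σ : OrthogonalRep r n} {m₁ m₂ : ℕ}
    {A : Matrix (n × Fin m₁) (n × Fin m₁) ℝ} {B : Matrix (n × Fin m₁) (n × Fin m₂) ℝ}
    {C : Matrix (n × Fin m₂) (n × Fin m₁) ℝ} {D : Matrix (n × Fin m₂) (n × Fin m₂) ℝ} :
    Matrix.fromBlocks A B C D ∈ (ρ.tensorSum σ m₁ m₂).commutant ↔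
      (∀ i j, A.submatrix (fun a => (a, i)) (fun b => (b, j)) ∈ ρ.commutant) ∧
      (∀ i j a, ρ.toAlgHom a * B.submatrix (fun a => (a, i)) (fun b => (b, j)) =
        B.submatrix (fun a => (a, i)) (fun b => (b, j)) * σ.toAlgHom a) ∧
      (∀ i j a, σ.toAlgHom a * C.submatrix (fun a => (a, i)) (fun b => (b, j)) =
        C.submatrix (fun a => (a, i)) (fun b => (b, j)) * ρ.toAlgHom a) ∧
      (∀ i j, D.submatrix (fun a => (a, i)) (fun b => (b, j)) ∈ σ.commutant) := by
  simp only [mem_commutant, tensorSum_toAlgHom_apply, Matrix.fromBlocks_multiply,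
    Matrix.fromBlocks_inj, Matrix.zero_mul, Matrix.mul_zero, add_zero, zero_add,
    kronecker_one_mul_eq_iff]
  exact ⟨fun h => ⟨fun i j a => (h a).1 i j, fun i j a => (h a).2.1 i j,
    fun i j a => (h a).2.2.1 i j, fun i j a => (h a).2.2.2 i j⟩,
    fun h a => ⟨fun i j => h.1 i j a, fun i j => h.2.1 i j a, fun i j => h.2.2.1 i j a,
      fun i j => h.2.2.2 i j a⟩⟩

variable {R : Type} [Ring R] [StarRing R] [Algebra ℝ R]

theorem exists_blockEmbedding_eq {ρ : OrthogonalRep r n} {φ : R →⋆ₐ[ℝ] Matrix n n ℝ}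
    (hφ : ∀ X, X ∈ ρ.commutant ↔ ∃ q, φ q = X) {m : ℕ} {X : Matrix (n × Fin m) (n × Fin m) ℝ}
    (hX : ∀ i j, X.submatrix (fun a => (a, i)) (fun b => (b, j)) ∈ ρ.commutant) :
    ∃ A, blockEmbedding φ m A = X := by
  choose A hA using fun i j => (hφ _).1 (hX i j)
  refine ⟨Matrix.of A, ?_⟩
  ext ⟨a, i⟩ ⟨b, j⟩
  exact congrFun (congrFun (hA i j) a) b

/-- If the commutants of two inequivalent irreducible representations `ρ` and `σ` are both
identified with the star algebra `R`, then the centralizer of the image of `spin(r)` in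
`ρ ⊗ ℝ^{m₁} ⊕ σ ⊗ ℝ^{m₂}` is the sum of the Lie algebras of skew-Hermitian matrices over `R`. -/
theorem nonempty_centralizer_lieEquiv {ρ σ : OrthogonalRep r n} (hρ : ρ.IsIrreducible)
    (hρσ : ¬ ρ.Equivalent σ) {φ ψ : R →⋆ₐ[ℝ] Matrix n n ℝ}
    (hφ : ∀ X, X ∈ ρ.commutant ↔ ∃ q, φ q = X) (hψ : ∀ X, X ∈ σ.commutant ↔ ∃ q, ψ q = X)
    (hφi : Function.Injective φ) (hψi : Function.Injective ψ) {m₁ m₂ : ℕ}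
    {L₁ : LieSubalgebra ℝ (Matrix (Fin m₁) (Fin m₁) R)}
    {L₂ : LieSubalgebra ℝ (Matrix (Fin m₂) (Fin m₂) R)}
    (hL₁ : ∀ A, A ∈ L₁ ↔ Aᴴ = -A) (hL₂ : ∀ A, A ∈ L₂ ↔ Aᴴ = -A) :
    Nonempty (centralizer (ρ.tensorSum σ m₁ m₂).spinHom.range ≃ₗ⁅ℝ⁆ (L₁ × L₂)) := by
  have hso : ∀ x : L₁ × L₂, Matrix.fromBlocks (blockEmbedding φ m₁ x.1) 0 0
      (blockEmbedding ψ m₂ x.2) ∈ LieAlgebra.Orthogonal.so _ ℝ := by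
    intro x
    rw [LieAlgebra.Orthogonal.mem_so, Matrix.fromBlocks_transpose, Matrix.fromBlocks_neg,
      ← blockEmbedding_conjTranspose, ← blockEmbedding_conjTranspose, (hL₁ _).1 x.1.2,
      (hL₂ _).1 x.2.2]
    simp
  have hcent : ∀ x : L₁ × L₂, (⟨_, hso x⟩ : LieAlgebra.Orthogonal.so _ ℝ) ∈
      centralizer (ρ.tensorSum σ m₁ m₂).spinHom.range := by
    intro x
    rw [mem_centralizer_spinHom_range_iff, fromBlocks_mem_commutant_tensorSum_iff]
    exact ⟨fun i j => (hφ _).2 ⟨_, rfl⟩, fun i j a => by simp, fun i j a => by simp,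
      fun i j => (hψ _).2 ⟨_, rfl⟩⟩
  let F : (L₁ × L₂) →ₗ⁅ℝ⁆ centralizer (ρ.tensorSum σ m₁ m₂).spinHom.range :=
    { toFun := fun x => ⟨⟨_, hso x⟩, hcent x⟩
      map_add' := fun x y => by
        refine Subtype.ext (Subtype.ext ?_)
        simp [Matrix.fromBlocks_add]
      map_smul' := fun c x => by
        refine Subtype.ext (Subtype.ext ?_)
        simp [Matrix.fromBlocks_smul]
      map_lie' := fun {x y} => by
        refine Subtype.ext (Subtype.ext ?_)
        simp [Ring.lie_def, Matrix.fromBlocks_multiply, blockEmbedding_mul, sub_eq_add_neg,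
          Matrix.fromBlocks_neg, Matrix.fromBlocks_add] }
  refine ⟨(LieEquiv.ofBijective F ⟨?_, ?_⟩).symm⟩
  · intro x y h
    have h' : Matrix.fromBlocks (blockEmbedding φ m₁ x.1) 0 0 (blockEmbedding ψ m₂ x.2) =
        Matrix.fromBlocks (blockEmbedding φ m₁ y.1) 0 0 (blockEmbedding ψ m₂ y.2) :=
      congrArg (fun z => z.1.1) h
    rw [Matrix.fromBlocks_inj] at h'
    exact Prod.ext (Subtype.ext (blockEmbedding_injective hφi _ h'.1))
      (Subtype.ext (blockEmbedding_injective hψi _ h'.2.2.2))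
  · rintro ⟨⟨X, hX⟩, hXc⟩
    have hXm : X ∈ (ρ.tensorSum σ m₁ m₂).commutant := mem_centralizer_spinHom_range_iff.1 hXc
    rw [LieAlgebra.Orthogonal.mem_so] at hX
    obtain ⟨A, B, C, D, rfl⟩ : ∃ A B C D, X = Matrix.fromBlocks A B C D :=
      ⟨_, _, _, _, X.fromBlocks_toBlocks.symm⟩
    obtain ⟨h₁, -, h₃, h₄⟩ := fromBlocks_mem_commutant_tensorSum_iff.1 hXm
    rw [Matrix.fromBlocks_transpose, Matrix.fromBlocks_neg, Matrix.fromBlocks_inj] at hX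
    have hC : C = 0 := by
      ext ⟨a, i⟩ ⟨b, j⟩
      exact congrFun (congrFun (eq_zero_of_intertwining_of_not_equivalent hρ hρσ
        fun a => (h₃ i j a).symm) a) b
    have hB : B = 0 := by
      rw [← neg_eq_zero, ← hX.2.1, hC, Matrix.transpose_zero]
    obtain ⟨A', rfl⟩ := exists_blockEmbedding_eq hφ h₁
    obtain ⟨D', rfl⟩ := exists_blockEmbedding_eq hψ h₄
    have hA' : A' ∈ L₁ := (hL₁ _).2 (blockEmbedding_injective hφi _ (by
      rw [blockEmbedding_conjTranspose, hX.1, map_neg]))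
    have hD' : D' ∈ L₂ := (hL₂ _).2 (blockEmbedding_injective hψi _ (by
      rw [blockEmbedding_conjTranspose, hX.2.2.2, map_neg]))
    refine ⟨(⟨A', hA'⟩, ⟨D', hD'⟩), Subtype.ext (Subtype.ext ?_)⟩
    subst hB hC
    rfl

end OrthogonalRep

end SpinCentralizer

theorem theorem2 (r d m₁ m₂ : ℕ) (hr : r % 4 = 0)
    (Δp Δm : OrthogonalRep r (Fin d))
    (hp : Δp.IsIrreducible) (hm : Δm.IsIrreducible) (hpm : ¬ Δp.Equivalent Δm) :
    (r % 8 = 0 →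
      Nonempty (centralizer (Δp.tensorSum Δm m₁ m₂).spinHom.range ≃ₗ⁅ℝ⁆
        (LieAlgebra.Orthogonal.so (Fin m₁) ℝ × LieAlgebra.Orthogonal.so (Fin m₂) ℝ))) ∧
    (r % 8 = 4 →
      Nonempty (centralizer (Δp.tensorSum Δm m₁ m₂).spinHom.range ≃ₗ⁅ℝ⁆
        (sp m₁ × sp m₂))) := by
  have := hp.1
  constructor
  · intro h8
    obtain ⟨φ, hφ⟩ := OrthogonalRep.exists_starAlgHom_real hp h8
    obtain ⟨ψ, hψ⟩ := OrthogonalRep.exists_starAlgHom_real hm h8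
    refine OrthogonalRep.nonempty_centralizer_lieEquiv hp hpm hφ hψ
      (RingHom.injective (φ : ℝ →+* Matrix (Fin d) (Fin d) ℝ))
      (RingHom.injective (ψ : ℝ →+* Matrix (Fin d) (Fin d) ℝ)) (fun A => ?_) (fun A => ?_) <;>
    rw [LieAlgebra.Orthogonal.mem_so, Matrix.conjTranspose_eq_transpose_of_trivial]
  · intro h8
    obtain ⟨φ, hφ⟩ := OrthogonalRep.exists_starAlgHom_quaternion hp h8
    obtain ⟨ψ, hψ⟩ := OrthogonalRep.exists_starAlgHom_quaternion hm h8
    exact OrthogonalRep.nonempty_centralizer_lieEquiv hp hpm hφ hψ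
      (RingHom.injective (φ : ℍ[ℝ] →+* Matrix (Fin d) (Fin d) ℝ))
      (RingHom.injective (ψ : ℍ[ℝ] →+* Matrix (Fin d) (Fin d) ℝ))
      (fun _ => Iff.rfl) (fun _ => Iff.rfl)
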